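/- Let $t\ge 1$, let $p_1,\dots,p_t$ be pairwise distinct primes with $p_j\equiv 1 \bmod 4$, and put $m=p_1\cdots p_t$. For a number field $L\subset\mathbb{C}$ that is abelian over $\mathbb{Q}$, its conductor is the least integer $n\ge 1$ with $L\subseteq\mathbb{Q}(\zeta_n)$, where $\zeta_n=e^{2\pi i/n}$. Then there are exactly $2^{t-1}$ cyclic quartic extensions $L/\mathbb{Q}$ inside $\mathbb{C}$ (that is, Galois extensions with cyclic Galois group of order $4$) with conductor $m$ and discriminant $m^3$. Moreover, for each $j$ let $\chi_j$ be any Dirichlet character modulo $p_j$ of order $4$. Every character modulo $m$ of the form $\chi=\prod_{j}\chi_j^{e_j}$ with all $e_j\in\{1,3\}$ has order $4$, and $\chi^3\neq\chi$ is again of this form. Sending the pair $\{\chi,\chi^3\}$ to the subfield of $\mathbb{Q}(\zeta_m)$ fixed by all automorphisms $\zeta_m\mapsto\zeta_m^a$ with $\gcd(a,m)=1$ and $\chi(a)=1$ defines a bijection from the set of these pairs onto the set of cyclic quartic extensions $L/\mathbb{Q}$ inside $\mathbb{C}$ with conductor $m$ and discriminant $m^3$. -/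

import Mathlib

open scoped BigOperators
open IntermediateField

namespace CyclicQuartic

/-- The cyclotomic field `ℚ(ζ_n)`, `ζ_n = exp (2πi / n)`, as a subfield of `ℂ`. -/
noncomputable def cyclo (n : ℕ) : IntermediateField ℚ ℂ :=
  ℚ⟮Complex.exp (2 * Real.pi * Complex.I / n)⟯

instance cyclo_isCyclotomicExtension (n : ℕ) [NeZero n] :
    IsCyclotomicExtension {n} ℚ (cyclo n) := by
  have h := Complex.isPrimitiveRoot_exp n (NeZero.ne n)
  have hi : IsIntegral ℚ (Complex.exp (2 * Real.pi * Complex.I / n)) :=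
    (h.isIntegral (NeZero.pos n)).tower_top
  change IsCyclotomicExtension {n} ℚ
    (ℚ⟮Complex.exp (2 * Real.pi * Complex.I / n)⟯).toSubalgebra
  rw [IntermediateField.adjoin_simple_toSubalgebra_of_isAlgebraic hi.isAlgebraic]
  exact h.adjoin_isCyclotomicExtension ℚ

instance cyclo_numberField (n : ℕ) [NeZero n] : NumberField (cyclo n) :=
  IsCyclotomicExtension.numberField {n} ℚ (cyclo n)

instance cyclo_isAbelianGalois (n : ℕ) [NeZero n] : IsAbelianGalois ℚ (cyclo n) :=
  IsCyclotomicExtension.isAbelianGalois {n} ℚ (cyclo n)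

/-- `L/ℚ` is a cyclic quartic extension. -/
def IsCyclicQuartic (L : IntermediateField ℚ ℂ) : Prop :=
  Module.finrank ℚ L = 4 ∧ IsGalois ℚ L ∧ IsCyclic Gal(L/ℚ)

/-- The conductor of an abelian number field `L ⊆ ℂ`: the least `n ≥ 1` with `L ⊆ ℚ(ζ_n)`.
(The value is `0` if `L` lies in no cyclotomic field.) -/
noncomputable def conductor (L : IntermediateField ℚ ℂ) : ℕ :=
  sInf {n : ℕ | 0 < n ∧ L ≤ cyclo n}

/-- The automorphisms `σ_a : ζ_n ↦ ζ_n ^ a` of `ℚ(ζ_n)` with `ψ a = 1` for every `ψ ∈ Q`. -/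
noncomputable def commonKer (n : ℕ) [NeZero n] (Q : Set (DirichletCharacter ℂ n)) :
    Subgroup Gal(cyclo n/ℚ) where
  carrier := {σ | ∀ ψ ∈ Q, ψ (IsCyclotomicExtension.Rat.galEquivZMod n (cyclo n) σ) = 1}
  one_mem' := fun ψ _ => by simp
  mul_mem' := fun {σ τ} hσ hτ ψ hψ => by
    rw [map_mul, Units.val_mul, map_mul, hσ ψ hψ, hτ ψ hψ, one_mul]
  inv_mem' := fun {σ} hσ ψ hψ => by
    have h := hσ ψ hψ
    have h2 : ψ (IsCyclotomicExtension.Rat.galEquivZMod n (cyclo n) (σ⁻¹ * σ)) = 1 := by simp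
    rwa [map_mul, Units.val_mul, map_mul, h, mul_one] at h2

/-- The subfield of `ℚ(ζ_n)` belonging to a set `Q` of Dirichlet characters modulo `n`: the fixed
field of all `σ_a` with `ψ a = 1` for every `ψ ∈ Q`. -/
noncomputable def fieldOfChars (n : ℕ) [NeZero n] (Q : Set (DirichletCharacter ℂ n)) :
    IntermediateField ℚ ℂ :=
  (IntermediateField.fixedField (commonKer n Q)).map
    (RingHom.toRatAlgHom (algebraMap (cyclo n) ℂ))

instance neZero_prod {t : ℕ} (p : Fin t → ℕ) [∀ j, Fact (p j).Prime] : NeZero (∏ j, p j) :=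
  ⟨Finset.prod_ne_zero_iff.mpr fun j _ => (Fact.out : (p j).Prime).ne_zero⟩

/-- The character `∏ j, χ_j ^ e_j` modulo `∏ j, p_j`. -/
noncomputable def charProd {t : ℕ} (p : Fin t → ℕ) (χ : ∀ j, DirichletCharacter ℂ (p j))
    (e : Fin t → ℕ) : DirichletCharacter ℂ (∏ j, p j) :=
  ∏ j, DirichletCharacter.changeLevel (Finset.dvd_prod_of_mem p (Finset.mem_univ j)) (χ j) ^ e j

/-- The characters `∏ j, χ_j ^ e_j` with all `e_j ∈ {0, 1, 2, 3}` odd. -/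
def oddChars {t : ℕ} (p : Fin t → ℕ) (χ : ∀ j, DirichletCharacter ℂ (p j)) :
    Set (DirichletCharacter ℂ (∏ j, p j)) :=
  {ψ | ∃ e : Fin t → ℕ, (∀ j, e j < 4 ∧ Odd (e j)) ∧ ψ = charProd p χ e}

/-- The cyclic quartic extensions of `ℚ` in `ℂ` with conductor `m` and discriminant `m ^ 3`. -/
def quarticFields (m : ℕ) : Set (IntermediateField ℚ ℂ) :=
  {L | IsCyclicQuartic L ∧ conductor L = m ∧
    ∃ _ : NumberField L, NumberField.discr L = (m : ℤ) ^ 3}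

end CyclicQuartic

/-!
Put `K = ℚ(ζ_m)`, `Gal(K/ℚ) = (ℤ/m)ˣ`, and `κ = ∏ j, χ_j ^ 2`, the product of the quadratic
characters modulo the `p j`. The proof rests on a description of both sides by `κ` and `√m`.

* The characters `∏ j, χ_j ^ e_j` with all `e_j` odd are exactly the solutions of `ψ ^ 2 = κ`
  (`mem_oddChars_iff`), since modulo a prime there is only one character of order two.
* The product of the quadratic Gauss sums modulo the `p j` is a square root of `m` in `K`, and `σ_a`
  multiplies it by `κ a` (`exists_sqrt_prod`). So for a cyclic quartic field `F ⊆ K` belonging to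
  the character `ψ`, the equation `ψ ^ 2 = κ` says that the quadratic subfield of `F` is `ℚ(√m)`.
* In a cyclic field of even degree, `√(discr F) = det (σ_i (b_j))` changes sign under a generator of
  the Galois group (`exists_sq_eq_discr_of_generator`), so it generates the quadratic subfield.

If `discr F = m ^ 3`, it follows that `√m ∈ F`, whence `ψ ^ 2 = κ`
(`exists_mem_oddChars_of_discr_eq`). Conversely, if the quadratic subfield is `ℚ(√m)`, then
`discr F` is `m` times a rational square. The exponent of a prime `p ∣ m` in `discr F` is therefore
odd; it is at least `2`, because `p` divides the discriminant of `ℚ(√m)`, whose square divides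
`discr F`; and it is less than `4`, because `discr F ^ [K : F]` divides `discr K`, in which `p` has
exponent less than `[K : ℚ]`. Primes not dividing `m` do not divide `discr K`. Hence
`discr F = m ^ 3` (`discr_eq_pow_three`), with no need of the conductor-discriminant formula. The
conductor is then `m` automatically: if `F ⊆ ℚ(ζ_n)`, then `m ^ 3` divides a power of `n`, so `m ∣ n`
(`conductor_eq_of_discr_eq`).

The passage between fields and characters is Mathlib's `intermediateFieldEquivSubgroupChar`, under
which cyclic quartic fields correspond to groups generated by a character of order four.
-/

namespace CyclicQuartic

/-! ### Discriminants of cyclic extensions of even degree -/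

/-- The discriminant of a Galois number field is the square of `δ = det (σ_i (b_j))`, on which an
automorphism acts through the sign of the permutation it induces on the Galois group. -/
theorem exists_sq_eq_discr (F : Type*) [Field F] [NumberField F] [IsGalois ℚ F]
    [DecidableEq Gal(F/ℚ)] :
    ∃ δ : F, δ ^ 2 = (NumberField.discr F : F) ∧
      ∀ g : Gal(F/ℚ), g δ = ((Equiv.Perm.sign (Equiv.mulLeft g) : ℤ) : F) * δ := by
  classical
  let ι := Module.Free.ChooseBasisIndex ℤ (NumberField.RingOfIntegers F)
  let b := NumberField.integralBasis F
  have hcard : Fintype.card ι = Fintype.card Gal(F/ℚ) := by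
    rw [← Nat.card_eq_fintype_card (α := Gal(F/ℚ)), IsGalois.card_aut_eq_finrank,
      Module.finrank_eq_card_basis b]
  let e : ι ≃ Gal(F/ℚ) := Fintype.equivOfCardEq hcard
  let N : Matrix ι ι F := Matrix.of fun j k => e k (b j)
  have hN : N * N.transpose = (Algebra.traceMatrix ℚ b).map (algebraMap ℚ F) := by
    ext j k
    rw [Matrix.map_apply, Algebra.traceMatrix_apply, Algebra.traceForm_apply,
      trace_eq_sum_automorphisms, Matrix.mul_apply, ← e.sum_comp]
    simp [N]
  refine ⟨N.det, ?_, fun g => ?_⟩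
  · have h := congrArg Matrix.det hN
    rw [Matrix.det_mul, Matrix.det_transpose, ← RingHom.mapMatrix_apply, ← RingHom.map_det,
      ← Algebra.discr_def, ← NumberField.coe_discr] at h
    simpa [sq] using h
  · let π : Equiv.Perm ι := (e.trans (Equiv.mulLeft g)).trans e.symm
    have h1 : N.map g = N.submatrix id π := by
      ext j k
      simp [N, π]
    have h2 : Equiv.Perm.sign π = Equiv.Perm.sign (Equiv.mulLeft g) :=
      Equiv.Perm.sign_symm_trans_trans (Equiv.mulLeft g) e.symm
    have h3 : g N.det = (N.map g).det := by
      have := RingHom.map_det (g : F →+* F) N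
      simpa using this
    rw [h3, h1, Matrix.det_permute', h2]

/-- Left multiplication by a generator of a finite group of even order is an odd permutation, being
a single cycle of even length. -/
theorem sign_mulLeft_generator {G : Type*} [Group G] [Fintype G] [DecidableEq G]
    (heven : Even (Fintype.card G)) {g : G} (hg : ∀ x, x ∈ Subgroup.zpowers g) :
    Equiv.Perm.sign (Equiv.mulLeft g) = -1 := by
  have hg1 : g ≠ 1 := by
    rintro rfl
    have hs : ∀ x : G, x = 1 := fun x => by simpa using hg x
    have : Fintype.card G = 1 := Fintype.card_eq_one_iff.mpr ⟨1, hs⟩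
    rw [this] at heven
    exact absurd heven (by decide)
  have hsupp : (Equiv.mulLeft g).support = Finset.univ := by
    ext x
    simp [Equiv.Perm.mem_support, hg1]
  have hcyc : (Equiv.mulLeft g).IsCycle := by
    refine ⟨1, by simpa using hg1, fun y _ => ?_⟩
    obtain ⟨k, hk⟩ := hg y
    refine ⟨k, ?_⟩
    have : (Equiv.mulLeft g) ^ k = Equiv.mulLeft (g ^ k) :=
      ((MulAction.toPermHom G G).map_zpow g k).symm
    rw [this]
    simpa using hk
  rw [hcyc.sign, hsupp, Finset.card_univ, heven.neg_one_pow]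

/-- An element of a Galois extension fixed by a generator of the Galois group is in the base. -/
theorem exists_algebraMap_eq_of_generator {K F : Type*} [Field K] [Field F] [Algebra K F]
    [FiniteDimensional K F] [IsGalois K F] {g : Gal(F/K)} (hg : ∀ x, x ∈ Subgroup.zpowers g)
    {x : F} (hx : g x = x) : ∃ r : K, algebraMap K F r = x := by
  refine (IsGalois.mem_range_algebraMap_iff_fixed x).mpr fun f => ?_
  have hle : Subgroup.zpowers g ≤ MulAction.stabilizer Gal(F/K) x :=
    Subgroup.zpowers_le.mpr hx
  exact hle (hg f)

theorem exists_sq_eq_discr_of_generator {F : Type*} [Field F] [NumberField F] [IsGalois ℚ F]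
    (heven : Even (Module.finrank ℚ F)) {g : Gal(F/ℚ)} (hg : ∀ x, x ∈ Subgroup.zpowers g) :
    ∃ δ : F, δ ^ 2 = (NumberField.discr F : F) ∧ g δ = -δ := by
  classical
  obtain ⟨δ, h1, h2⟩ := exists_sq_eq_discr F
  refine ⟨δ, h1, ?_⟩
  rw [h2 g, sign_mulLeft_generator _ hg]
  · simp
  · rwa [← Nat.card_eq_fintype_card, IsGalois.card_aut_eq_finrank]

/-- In a cyclic number field of even degree, `√(discr F)` generates the quadratic subfield; so if
`√m` does as well, then `discr F` and `m` agree up to a rational square. -/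
theorem exists_discr_eq_sq_mul {F : Type*} [Field F] [NumberField F] [IsGalois ℚ F]
    (heven : Even (Module.finrank ℚ F)) {g : Gal(F/ℚ)} (hg : ∀ x, x ∈ Subgroup.zpowers g)
    {s : F} {m : ℕ} (hm : m ≠ 0) (hs : s ^ 2 = m) (hgs : g s = -s) :
    ∃ r : ℚ, (NumberField.discr F : ℚ) = r ^ 2 * m := by
  obtain ⟨δ, h1, h2⟩ := exists_sq_eq_discr_of_generator heven hg
  have hs0 : s ≠ 0 := by
    rintro rfl
    exact hm (by exact_mod_cast (by simpa using hs.symm : (m : F) = 0))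
  obtain ⟨r, hr⟩ := exists_algebraMap_eq_of_generator hg
    (show g (δ / s) = δ / s by rw [map_div₀, h2, hgs, neg_div_neg_eq])
  refine ⟨r, (algebraMap ℚ F).injective ?_⟩
  rw [map_mul, map_pow, hr, map_natCast, ← hs, map_intCast, ← h1]
  field_simp

/-- If `d = r² m` with `r` rational and `p` divides `m` exactly once, then the exponent of `p` in
`d` is odd. -/
theorem odd_factorization_of_eq_sq_mul {d : ℤ} {m p : ℕ} (hp : p.Prime) (hd : d ≠ 0)
    (hm : m.factorization p = 1) {r : ℚ} (h : (d : ℚ) = r ^ 2 * m) :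
    Odd (d.natAbs.factorization p) := by
  have := Fact.mk hp
  have hm0 : (m : ℚ) ≠ 0 := by
    have : m ≠ 0 := by rintro rfl; simp at hm
    exact_mod_cast this
  have hr : r ≠ 0 := by
    rintro rfl
    apply hd
    exact_mod_cast (by simpa using h : (d : ℚ) = 0)
  have hv := congrArg (padicValRat p) h
  rw [padicValRat.mul (pow_ne_zero 2 hr) hm0, padicValRat.pow, padicValRat.of_int,
    padicValRat.of_nat, padicValInt, ← Nat.factorization_def _ hp, ← Nat.factorization_def _ hp,
    hm] at hv
  have : Odd ((d.natAbs.factorization p : ℕ) : ℤ) := ⟨padicValRat p r, by push_cast at hv ⊢; omega⟩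
  exact_mod_cast this

theorem discr_pow_dvd_discr (K L : Type*) [Field K] [NumberField K] [Field L] [NumberField L]
    [Algebra K L] :
    (NumberField.discr K).natAbs ^ Module.finrank K L ∣ (NumberField.discr L).natAbs := by
  rw [NumberField.natAbs_discr_eq_absNorm_differentIdeal_mul_natAbs_discr_pow K
    (NumberField.RingOfIntegers K) L (NumberField.RingOfIntegers L)]
  exact dvd_mul_left _ _

/-- A prime dividing `m` exactly once divides the discriminant of a number field that contains
`√m`, and does so at least `[L : ℚ] / 2` times. -/
theorem pow_dvd_discr_of_sq_eq {L : Type*} [Field L] [NumberField L] {s : L} {m p : ℕ}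
    (hp : p.Prime) (hm : m.factorization p = 1) (hs : s ^ 2 = m) :
    p ^ (Module.finrank ℚ L / 2) ∣ (NumberField.discr L).natAbs := by
  have hm0 : m ≠ 0 := by rintro rfl; simp at hm
  have hsint : IsIntegral ℚ s := Algebra.IsIntegral.isIntegral s
  -- `m` is not a rational square, as `p` divides it exactly once
  have hirr : ∀ r : ℚ, algebraMap ℚ L r ≠ s := by
    rintro r rfl
    have h : ((1 : ℤ) : ℚ) = (r⁻¹) ^ 2 * m := by
      have h2 : r ^ 2 = m := (algebraMap ℚ L).injective (by simpa using hs)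
      have hr : r ≠ 0 := by
        rintro rfl
        exact hm0 (by exact_mod_cast (by simpa using h2.symm : (m : ℚ) = 0))
      rw [← h2]; field_simp; simp
    have := odd_factorization_of_eq_sq_mul hp one_ne_zero hm h
    simp at this
  have hdeg : Module.finrank ℚ ℚ⟮s⟯ = 2 := by
    rw [IntermediateField.adjoin.finrank hsint]
    apply le_antisymm
    · have hdvd : minpoly ℚ s ∣ (Polynomial.X ^ 2 - Polynomial.C (m : ℚ)) :=
        minpoly.dvd _ _ (by simp [hs])
      calc _ ≤ (Polynomial.X ^ 2 - Polynomial.C (m : ℚ)).natDegree :=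
            Polynomial.natDegree_le_of_dvd hdvd
              (Polynomial.X_pow_sub_C_ne_zero (by norm_num) _)
        _ = 2 := Polynomial.natDegree_X_pow_sub_C
    · rw [minpoly.two_le_natDegree_iff hsint]
      rintro ⟨r, hr⟩
      exact hirr r hr
  have : Algebra.IsQuadraticExtension ℚ ℚ⟮s⟯ := ⟨hdeg⟩
  have : IsGalois ℚ ℚ⟮s⟯ := {}
  set s' : ℚ⟮s⟯ := AdjoinSimple.gen ℚ s with hs'
  have hs2 : s' ^ 2 = m := by
    apply (algebraMap ℚ⟮s⟯ L).injective
    simp [hs', hs]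
  have hcard : Nat.card Gal(ℚ⟮s⟯/ℚ) = 2 := by rw [IsGalois.card_aut_eq_finrank, hdeg]
  have : Fact (Nat.Prime 2) := ⟨Nat.prime_two⟩
  have : Nontrivial Gal(ℚ⟮s⟯/ℚ) := Finite.one_lt_card_iff_nontrivial.mp (by omega)
  obtain ⟨g, hg1⟩ := exists_ne (1 : Gal(ℚ⟮s⟯/ℚ))
  have hg : ∀ x, x ∈ Subgroup.zpowers g := fun x =>
    mem_zpowers_of_prime_card hcard hg1
  have hgs : g s' = -s' := by
    have h : g s' ^ 2 = s' ^ 2 := by rw [← map_pow, hs2, map_natCast]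
    refine (sq_eq_sq_iff_eq_or_eq_neg.mp h).resolve_left fun h1 => ?_
    obtain ⟨r, hr⟩ := exists_algebraMap_eq_of_generator hg h1
    apply hirr r
    rw [IsScalarTower.algebraMap_apply ℚ ℚ⟮s⟯ L, hr, hs']
    exact AdjoinSimple.algebraMap_gen ℚ s
  obtain ⟨r, hr⟩ := exists_discr_eq_sq_mul (by rw [hdeg]; decide) hg hm0 hs2 hgs
  have hodd := odd_factorization_of_eq_sq_mul hp (NumberField.discr_ne_zero _) hm hr
  have hdvd : p ∣ (NumberField.discr ℚ⟮s⟯).natAbs := Nat.dvd_of_factorization_pos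
    (by rintro h; rw [h] at hodd; exact absurd hodd (by decide))
  have hfin : Module.finrank ℚ L / 2 = Module.finrank ℚ⟮s⟯ L := by
    rw [← Module.finrank_mul_finrank ℚ ℚ⟮s⟯ L, hdeg]; simp
  rw [hfin]
  exact (pow_dvd_pow_of_dvd hdvd _).trans (discr_pow_dvd_discr ℚ⟮s⟯ L)

/-! ### Discriminants of subfields of cyclotomic fields -/

theorem dvd_of_dvd_discr_cyclotomic {n p : ℕ} [NeZero n] (K : Type*) [Field K] [NumberField K]
    [IsCyclotomicExtension {n} ℚ K] (hp : p.Prime) (h : p ∣ (NumberField.discr K).natAbs) :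
    p ∣ n := by
  rw [IsCyclotomicExtension.Rat.natAbs_discr n K] at h
  exact hp.dvd_of_dvd_pow (h.trans (Nat.div_dvd_of_dvd
    (Nat.prod_primeFactors_pow_totient_ediv_dvd (NeZero.pos n))))

/-- A prime dividing `n` exactly once is tamely ramified in the `n`-th cyclotomic field, so it
divides the discriminant less often than the degree. -/
theorem factorization_discr_cyclotomic_lt {n p : ℕ} [NeZero n] (K : Type*) [Field K]
    [NumberField K] [IsCyclotomicExtension {n} ℚ K] (hp : p.Prime) (hn : n.factorization p = 1) :
    (NumberField.discr K).natAbs.factorization p < n.totient := by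
  have hpn : p ∣ n := Nat.dvd_of_factorization_pos (by omega)
  rw [IsCyclotomicExtension.Rat.natAbs_discr n K, Nat.factorization_div
    (Nat.prod_primeFactors_pow_totient_ediv_dvd (NeZero.pos n)), Finsupp.tsub_apply,
    Nat.factorization_pow, Finsupp.smul_apply, hn, smul_eq_mul, mul_one]
  refine Nat.sub_lt (Nat.totient_pos.mpr (NeZero.pos n)) ?_
  have hpos : 0 < n.totient / (p - 1) :=
    Nat.div_pos (Nat.le_of_dvd (Nat.totient_pos.mpr (NeZero.pos n))
      (by simpa [Nat.totient_prime hp] using Nat.totient_dvd_of_dvd hpn))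
      (by have := hp.two_le; omega)
  refine hp.factorization_pos_of_dvd
    (Finset.prod_ne_zero_iff.mpr fun q hq => pow_ne_zero _ (Nat.prime_of_mem_primeFactors hq).ne_zero)
    ?_
  exact (dvd_pow_self p hpos.ne').trans
    (Finset.dvd_prod_of_mem (fun q => q ^ (n.totient / (q - 1)))
      (Nat.mem_primeFactors.mpr ⟨hp, hpn, NeZero.ne n⟩))

/-- A cyclic quartic subfield of the `m`-th cyclotomic field, `m` squarefree, whose quadratic
subfield is generated by `√m`, has discriminant `m ^ 3`: the exponent of a prime `p ∣ m` is odd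
because `√(discr F)` generates `ℚ(√m)`, at least `2` because `p` ramifies in `ℚ(√m)`, and less than
`4` because `p` is tamely ramified. -/
theorem discr_eq_pow_three {m : ℕ} [NeZero m] (hm : Squarefree m) {K : Type*} [Field K]
    [NumberField K] [IsCyclotomicExtension {m} ℚ K] (F : IntermediateField ℚ K) [IsGalois ℚ F]
    (hF : Module.finrank ℚ F = 4) {g : Gal(F/ℚ)} (hg : ∀ x, x ∈ Subgroup.zpowers g) {s : F}
    (hs : s ^ 2 = m) (hgs : g s = -s) : NumberField.discr F = (m : ℤ) ^ 3 := by
  obtain ⟨r, hr⟩ := exists_discr_eq_sq_mul (by rw [hF]; decide) hg (NeZero.ne m) hs hgs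
  have h0 : NumberField.discr F ≠ 0 := NumberField.discr_ne_zero F
  have hnonneg : 0 ≤ NumberField.discr F := by
    have : (0 : ℚ) ≤ NumberField.discr F := by rw [hr]; positivity
    exact_mod_cast this
  have hfin : 4 * Module.finrank F K = m.totient := by
    rw [← hF, Module.finrank_mul_finrank, IsCyclotomicExtension.Rat.finrank m K]
  have hdvd := discr_pow_dvd_discr F K
  have hK0 : (NumberField.discr K).natAbs ≠ 0 :=
    Int.natAbs_ne_zero.mpr (NumberField.discr_ne_zero K)
  have hF0 : (NumberField.discr F).natAbs ≠ 0 := Int.natAbs_ne_zero.mpr h0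
  have key : (NumberField.discr F).natAbs = m ^ 3 := by
    refine Nat.eq_of_factorization_eq hF0 (pow_ne_zero 3 (NeZero.ne m)) fun p => ?_
    rw [Nat.factorization_pow, Finsupp.smul_apply, smul_eq_mul]
    by_cases hp : p.Prime
    swap
    · simp [Nat.factorization_eq_zero_of_not_prime _ hp]
    by_cases hpm : p ∣ m
    · have hm1 : m.factorization p = 1 :=
        le_antisymm (hm.natFactorization_le_one p)
          (hp.factorization_pos_of_dvd (NeZero.ne m) hpm)
      have hodd := odd_factorization_of_eq_sq_mul hp h0 hm1 hr
      have h2 : 2 ≤ (NumberField.discr F).natAbs.factorization p := by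
        have := pow_dvd_discr_of_sq_eq hp hm1 hs
        rw [hF] at this
        exact (hp.pow_dvd_iff_le_factorization hF0).mp this
      have h4 : (NumberField.discr F).natAbs.factorization p < 4 := by
        have h := (Nat.factorization_le_iff_dvd (pow_ne_zero _ hF0) hK0).mpr hdvd p
        rw [Nat.factorization_pow, Finsupp.smul_apply, smul_eq_mul] at h
        have hlt := h.trans_lt (factorization_discr_cyclotomic_lt K hp hm1)
        rw [← hfin, mul_comm 4] at hlt
        exact Nat.lt_of_mul_lt_mul_left hlt
      obtain ⟨k, hk⟩ := hodd
      rw [hm1]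
      omega
    · rw [Nat.factorization_eq_zero_of_not_dvd hpm, Nat.factorization_eq_zero_of_not_dvd]
      intro h
      exact hpm (dvd_of_dvd_discr_cyclotomic K hp
        (h.trans (Int.natAbs_dvd_natAbs.mpr (NumberField.discr_dvd_discr F K))))
  rw [← Int.natAbs_of_nonneg hnonneg, key]
  push_cast
  rfl

/-! ### Dirichlet characters of order two and four -/

/-- The group of characters of `(ℤ/p)ˣ` contains only one element of order two, as a character is
determined by its value at a primitive root. -/
theorem eq_of_sq_eq_one {p : ℕ} [Fact p.Prime] {η θ : DirichletCharacter ℂ p} (hη : η ^ 2 = 1)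
    (hη1 : η ≠ 1) (hθ : θ ^ 2 = 1) (hθ1 : θ ≠ 1) : η = θ := by
  obtain ⟨g, hg⟩ := IsCyclic.exists_generator (α := (ZMod p)ˣ)
  have hext : ∀ φ₁ φ₂ : DirichletCharacter ℂ p, φ₁ g = φ₂ g → φ₁ = φ₂ := by
    intro φ₁ φ₂ h
    have h' : φ₁.toUnitHom g = φ₂.toUnitHom g :=
      Units.ext (by rw [MulChar.coe_toUnitHom, MulChar.coe_toUnitHom, h])
    ext u
    obtain ⟨k, rfl⟩ := hg u
    rw [← MulChar.coe_toUnitHom, ← MulChar.coe_toUnitHom]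
    simp only [map_zpow, h']
  have hneg : ∀ φ : DirichletCharacter ℂ p, φ ^ 2 = 1 → φ ≠ 1 → φ g = -1 := by
    intro φ h2 h1
    have h : φ g ^ 2 = 1 := by rw [← MulChar.pow_apply_coe, h2, MulChar.one_apply_coe]
    refine (sq_eq_sq_iff_eq_or_eq_neg.mp (h.trans (one_pow 2).symm)).resolve_left
      fun h => h1 (hext _ _ ?_)
    rw [h, MulChar.one_apply_coe]
  exact hext _ _ (by rw [hneg η hη hη1, hneg θ hθ hθ1])

theorem exists_sq_apply_eq_neg_one {n : ℕ} {χ : DirichletCharacter ℂ n} (hχ : orderOf χ = 4) :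
    ∃ u : (ZMod n)ˣ, χ u ^ 2 = -1 := by
  have h2 : χ ^ 2 ≠ 1 := fun h => by
    have := orderOf_dvd_of_pow_eq_one h
    rw [hχ] at this
    exact absurd this (by decide)
  obtain ⟨u, hu⟩ := MulChar.ne_one_iff.mp h2
  refine ⟨u, (sq_eq_sq_iff_eq_or_eq_neg.mp ?_).resolve_left (by rwa [← MulChar.pow_apply_coe])⟩
  rw [one_pow, ← pow_mul, show 2 * 2 = 4 by norm_num, ← MulChar.pow_apply_coe, ← hχ,
    pow_orderOf_eq_one, MulChar.one_apply_coe]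

theorem orderOf_eq_four_of_sq {G : Type*} [Monoid G] {x : G} (h2 : x ^ 2 ≠ 1)
    (h4 : (x ^ 2) ^ 2 = 1) : orderOf x = 4 :=
  have : Fact (Nat.Prime 2) := ⟨Nat.prime_two⟩
  orderOf_eq_prime_pow (p := 2) (n := 1) (by simpa using h2) (by rwa [← pow_mul] at h4)

theorem pow_three_ne_of_orderOf_eq_four {G : Type*} [Group G] {x : G} (hx : orderOf x = 4) :
    x ^ 3 ≠ x := by
  intro h
  have h2 : x ^ 2 = 1 := mul_right_cancel (b := x) (by rw [← pow_succ, h, one_mul])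
  exact absurd (orderOf_dvd_of_pow_eq_one h2) (by rw [hx]; decide)

theorem eq_or_eq_pow_three_of_mem_zpowers {G : Type*} [Group G] {x y : G} (hx : orderOf x = 4)
    (hy : orderOf y = 4) (h : y ∈ Subgroup.zpowers x) : y = x ∨ y = x ^ 3 := by
  have hfin : IsOfFinOrder x := orderOf_pos_iff.mp (by omega)
  classical
  obtain ⟨k, hk, rfl⟩ := Finset.mem_image.mp
    (hfin.mem_powers_iff_mem_range_orderOf.mp (hfin.mem_powers_iff_mem_zpowers.mpr h))
  rw [hx, Finset.mem_range] at hk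
  interval_cases k
  · simp at hy
  · simp
  · have h4 : (x ^ 2) ^ 2 = 1 := by rw [← pow_mul, show 2 * 2 = 4 from rfl, ← hx, pow_orderOf_eq_one]
    have := orderOf_dvd_of_pow_eq_one h4
    rw [hy] at this
    exact absurd this (by decide)
  · exact Or.inr rfl

/-! ### Products of characters of distinct prime moduli -/

theorem dvd_prod {t : ℕ} (p : Fin t → ℕ) (j : Fin t) : p j ∣ ∏ i, p i :=
  Finset.dvd_prod_of_mem p (Finset.mem_univ j)

theorem charProd_apply {t : ℕ} (p : Fin t → ℕ) (χ : ∀ j, DirichletCharacter ℂ (p j)) (e : Fin t → ℕ)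
    (u : (ZMod (∏ j, p j))ˣ) :
    charProd p χ e u = ∏ j, χ j (ZMod.unitsMap (dvd_prod p j) u) ^ e j := by
  rw [← MulChar.coe_toUnitHom, charProd, MulChar.toUnitHom_eq, ← MulChar.mulEquivToUnitHom_apply,
    map_prod, MonoidHom.finsetProd_apply, Units.coe_prod]
  refine Finset.prod_congr rfl fun j _ => ?_
  rw [map_pow, MonoidHom.pow_apply, Units.val_pow_eq_pow_val, MulChar.mulEquivToUnitHom_apply,
    ← MulChar.toUnitHom_eq, DirichletCharacter.changeLevel_toUnitHom, MonoidHom.comp_apply,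
    MulChar.coe_toUnitHom]

section Product

variable {t : ℕ} (p : Fin t → ℕ) [∀ j, Fact (p j).Prime] (hinj : Function.Injective p)
  (χ : ∀ j, DirichletCharacter ℂ (p j))

include hinj in
theorem pairwise_coprime : Pairwise (Function.onFun Nat.Coprime p) := fun _ _ hij =>
  (Nat.coprime_primes Fact.out Fact.out).mpr fun h => hij (hinj h)

/-- The Chinese remainder theorem for unit groups: the factorization of `(ℤ/m)ˣ`. -/
noncomputable def unitsEquivPi (hinj : Function.Injective p) :
    (ZMod (∏ j, p j))ˣ ≃* ∀ j, (ZMod (p j))ˣ :=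
  (Units.mapEquiv (ZMod.prodEquivPi p (pairwise_coprime p hinj)).toMulEquiv).trans
    MulEquiv.piUnits

theorem unitsEquivPi_apply (u : (ZMod (∏ j, p j))ˣ) (j : Fin t) :
    unitsEquivPi p hinj u j = ZMod.unitsMap (dvd_prod p j) u := by
  ext
  simp [unitsEquivPi, ZMod.unitsMap]

theorem unitsMap_symm_mulSingle_self (j : Fin t) (u : (ZMod (p j))ˣ) :
    ZMod.unitsMap (dvd_prod p j) ((unitsEquivPi p hinj).symm (Pi.mulSingle j u)) = u := by
  rw [← unitsEquivPi_apply p hinj, MulEquiv.apply_symm_apply, Pi.mulSingle_eq_same]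

theorem unitsMap_symm_mulSingle_of_ne {i j : Fin t} (hij : i ≠ j) (u : (ZMod (p j))ˣ) :
    ZMod.unitsMap (dvd_prod p i) ((unitsEquivPi p hinj).symm (Pi.mulSingle j u)) = 1 := by
  rw [← unitsEquivPi_apply p hinj, MulEquiv.apply_symm_apply, Pi.mulSingle_eq_of_ne hij]

theorem charProd_apply_symm_mulSingle (e : Fin t → ℕ) (j : Fin t) (u : (ZMod (p j))ˣ) :
    charProd p χ e ((unitsEquivPi p hinj).symm (Pi.mulSingle j u)) = χ j u ^ e j := by
  rw [charProd_apply, Finset.prod_eq_single j]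
  · rw [unitsMap_symm_mulSingle_self]
  · intro i _ hij
    rw [unitsMap_symm_mulSingle_of_ne p hinj hij, Units.val_one, MulChar.map_one, one_pow]
  · simp

/-- The component modulo `p j` of a character modulo `∏ j, p j`. -/
noncomputable def component (hinj : Function.Injective p) (ψ : DirichletCharacter ℂ (∏ j, p j))
    (j : Fin t) : DirichletCharacter ℂ (p j) :=
  MulChar.ofUnitHom (ψ.toUnitHom.comp
    ((unitsEquivPi p hinj).symm.toMonoidHom.comp (MonoidHom.mulSingle (fun j => (ZMod (p j))ˣ) j)))

theorem component_apply (ψ : DirichletCharacter ℂ (∏ j, p j)) (j : Fin t) (u : (ZMod (p j))ˣ) :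
    component p hinj ψ j u = ψ ((unitsEquivPi p hinj).symm (Pi.mulSingle j u)) := by
  rw [component, MulChar.ofUnitHom_coe, MonoidHom.comp_apply, MulChar.coe_toUnitHom]
  rfl

theorem apply_eq_prod_component (ψ : DirichletCharacter ℂ (∏ j, p j))
    (u : (ZMod (∏ j, p j))ˣ) :
    ψ u = ∏ j, component p hinj ψ j (ZMod.unitsMap (dvd_prod p j) u) := by
  simp_rw [component_apply, ← MulChar.coe_toUnitHom, ← Units.coe_prod, ← map_prod,
    ← unitsEquivPi_apply p hinj, Finset.univ_prod_mulSingle, MulEquiv.symm_apply_apply]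

variable {χ} (hχ : ∀ j, orderOf (χ j) = 4)

include hχ

theorem pow_four_eq_one (j : Fin t) (u : (ZMod (p j))ˣ) : χ j u ^ 4 = 1 := by
  rw [← MulChar.pow_apply_coe, ← hχ j, pow_orderOf_eq_one, MulChar.one_apply_coe]

include hinj in
/-- The characters with all exponents odd are the square roots of the quadratic character
`∏ j, χ_j ^ 2`. -/
theorem mem_oddChars_iff (ψ : DirichletCharacter ℂ (∏ j, p j)) :
    ψ ∈ oddChars p χ ↔ ψ ^ 2 = charProd p χ fun _ => 2 := by
  constructor
  · rintro ⟨e, he, rfl⟩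
    ext u
    rw [MulChar.pow_apply_coe, charProd_apply, charProd_apply, ← Finset.prod_pow]
    refine Finset.prod_congr rfl fun j _ => ?_
    obtain ⟨k, hk⟩ := (he j).2
    rw [← pow_mul, hk, show (2 * k + 1) * 2 = 4 * k + 2 by ring, pow_add, pow_mul,
      pow_four_eq_one p hχ, one_pow, one_mul]
  · intro h
    have hcomp : ∀ j, component p hinj ψ j = χ j ∨ component p hinj ψ j = χ j ^ 3 := by
      intro j
      have hsq : component p hinj ψ j ^ 2 = χ j ^ 2 := by
        ext u
        rw [MulChar.pow_apply_coe, MulChar.pow_apply_coe, component_apply,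
          ← MulChar.pow_apply_coe, h, charProd_apply_symm_mulSingle]
      have h4 : (χ j) ^ 4 = 1 := by rw [← hχ j, pow_orderOf_eq_one]
      by_cases h1 : component p hinj ψ j * (χ j)⁻¹ = 1
      · exact Or.inl (mul_inv_eq_one.mp h1)
      · right
        have := eq_of_sq_eq_one (η := component p hinj ψ j * (χ j)⁻¹) (θ := χ j ^ 2)
          (by rw [mul_pow, hsq, inv_pow, mul_inv_cancel]) h1
          (by rw [← pow_mul, h4])
          (fun h => absurd (orderOf_dvd_of_pow_eq_one h) (by rw [hχ j]; decide))
        rw [mul_inv_eq_iff_eq_mul.mp this, ← pow_succ]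
    refine ⟨fun j => if component p hinj ψ j = χ j then 1 else 3, fun j => ?_, ?_⟩
    · dsimp only
      split_ifs <;> decide
    · ext u
      rw [apply_eq_prod_component p hinj, charProd_apply]
      refine Finset.prod_congr rfl fun j _ => ?_
      split_ifs with hj
      · rw [hj, pow_one]
      · rw [(hcomp j).resolve_left hj, MulChar.pow_apply_coe]

theorem charProd_two_sq : (charProd p χ fun _ => 2) ^ 2 = 1 := by
  ext u
  rw [MulChar.pow_apply_coe, charProd_apply, ← Finset.prod_pow, MulChar.one_apply_coe]
  refine Finset.prod_eq_one fun j _ => ?_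
  rw [← pow_mul, pow_four_eq_one p hχ]

include hinj in
theorem charProd_two_ne_one (ht : 1 ≤ t) : (charProd p χ fun _ => 2) ≠ 1 := by
  obtain ⟨u, hu⟩ := exists_sq_apply_eq_neg_one (hχ ⟨0, ht⟩)
  refine MulChar.ne_one_iff.mpr ⟨(unitsEquivPi p hinj).symm (Pi.mulSingle ⟨0, ht⟩ u), ?_⟩
  rw [charProd_apply_symm_mulSingle, hu]
  norm_num

include hinj in
theorem orderOf_eq_four_of_mem_oddChars (ht : 1 ≤ t) {ψ : DirichletCharacter ℂ (∏ j, p j)}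
    (hψ : ψ ∈ oddChars p χ) : orderOf ψ = 4 := by
  rw [mem_oddChars_iff p hinj hχ] at hψ
  exact orderOf_eq_four_of_sq (hψ ▸ charProd_two_ne_one p hinj hχ ht)
    (hψ ▸ charProd_two_sq p hχ)

include hinj in
theorem pow_three_mem_oddChars {ψ : DirichletCharacter ℂ (∏ j, p j)}
    (hψ : ψ ∈ oddChars p χ) : ψ ^ 3 ∈ oddChars p χ := by
  rw [mem_oddChars_iff p hinj hχ] at hψ ⊢
  rw [← pow_mul, mul_comm, pow_mul, hψ, pow_succ, charProd_two_sq p hχ, one_mul]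

include hinj in
theorem ncard_oddChars : (oddChars p χ).ncard = 2 ^ t := by
  have himg : oddChars p χ =
      charProd p χ '' (Fintype.piFinset fun _ : Fin t => ({1, 3} : Finset ℕ)) := by
    ext ψ
    simp only [oddChars, Set.mem_ofPred_eq, Set.mem_image, Finset.mem_coe, Fintype.mem_piFinset,
      Finset.mem_insert, Finset.mem_singleton]
    refine exists_congr fun e => and_congr (forall_congr' fun j => ?_) eq_comm
    constructor
    · rintro ⟨h1, k, hk⟩
      omega
    · rintro (h | h) <;> rw [h] <;> decide
  have hinjOn : Set.InjOn (charProd p χ)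
      (Fintype.piFinset fun _ : Fin t => ({1, 3} : Finset ℕ)) := by
    intro e he e' he' h
    simp only [Finset.mem_coe, Fintype.mem_piFinset, Finset.mem_insert,
      Finset.mem_singleton] at he he'
    ext j
    obtain ⟨u, hu⟩ := exists_sq_apply_eq_neg_one (hχ j)
    have h' := charProd_apply_symm_mulSingle p hinj χ e j u
    rw [h, charProd_apply_symm_mulSingle] at h'
    have h0 : χ j u ≠ 0 := by intro h0; simp [h0] at hu
    -- the value `x` of `χ j` at `u` satisfies `x ^ 3 = -x ≠ x`
    have h3 : χ j u ^ 3 = -χ j u := by rw [pow_succ, hu, neg_one_mul]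
    rcases he j with h1 | h1 <;> rcases he' j with h2 | h2 <;> rw [h1, h2] at h' ⊢ <;>
      rw [pow_one, h3] at h'
    · exact absurd h' (by simpa [neg_eq_self] using h0)
    · exact absurd h' (by simpa [self_eq_neg] using h0)
  rw [himg, hinjOn.ncard_image, Set.ncard_coe_finset, Fintype.card_piFinset]
  simp

include hinj in
/-- The characters with all exponents odd fall into pairs `{ψ, ψ ^ 3}`. -/
theorem two_mul_ncard_pairs (ht : 1 ≤ t) :
    2 * {Q : Set (DirichletCharacter ℂ (∏ j, p j)) |
      ∃ ψ ∈ oddChars p χ, Q = {ψ, ψ ^ 3}}.ncard = 2 ^ t := by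
  classical
  have hfin : (oddChars p χ).Finite := Set.toFinite _
  let f (ψ : DirichletCharacter ℂ (∏ j, p j)) : Set (DirichletCharacter ℂ (∏ j, p j)) := {ψ, ψ ^ 3}
  have himg : {Q : Set (DirichletCharacter ℂ (∏ j, p j)) | ∃ ψ ∈ oddChars p χ, Q = {ψ, ψ ^ 3}} =
      (hfin.toFinset.image f : Set (Set (DirichletCharacter ℂ (∏ j, p j)))) := by
    ext Q
    simp [f, eq_comm]
  rw [himg, Set.ncard_coe_finset, ← ncard_oddChars p hinj hχ, Set.ncard_eq_toFinset_card _ hfin,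
    Finset.card_eq_sum_card_image f hfin.toFinset, mul_comm]
  refine (Finset.sum_const_nat fun Q hQ => ?_).symm
  obtain ⟨ψ, hψ, rfl⟩ := Finset.mem_image.mp hQ
  rw [Set.Finite.mem_toFinset] at hψ
  have h4 := orderOf_eq_four_of_mem_oddChars p hinj hχ ht hψ
  have hpow4 : ψ ^ 4 = 1 := by rw [← h4, pow_orderOf_eq_one]
  have hpair : hfin.toFinset.filter (fun φ => f φ = f ψ) = {ψ, ψ ^ 3} := by
    ext φ
    simp only [Finset.mem_filter, Set.Finite.mem_toFinset, Finset.mem_insert,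
      Finset.mem_singleton]
    constructor
    · rintro ⟨-, h⟩
      have : φ ∈ f ψ := h ▸ Set.mem_insert _ _
      simpa [f] using this
    · rintro (rfl | rfl)
      · exact ⟨hψ, rfl⟩
      · refine ⟨pow_three_mem_oddChars p hinj hχ hψ, ?_⟩
        simp only [f]
        rw [← pow_mul, show 3 * 3 = 4 * 2 + 1 by norm_num, pow_add, pow_mul, hpow4, one_pow,
          one_mul, pow_one, Set.pair_comm]
  rw [hpair, Finset.card_pair (pow_three_ne_of_orderOf_eq_four h4).symm]

end Product

/-! ### Gauss sums and the square root of the conductor -/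

/-- The quadratic Gauss sum modulo a prime `p ≡ 1 mod 4` is a square root of `p` in the cyclotomic
field, and `σ_a` multiplies it by the quadratic residue symbol of `a`. -/
theorem exists_sqrt_prime {n p : ℕ} [NeZero n] [Fact p.Prime] (hmod : p ≡ 1 [MOD 4]) (hpn : p ∣ n)
    (K : Type*) [Field K] [NumberField K] [IsCyclotomicExtension {n} ℚ K] :
    ∃ s : K, s ^ 2 = p ∧ ∀ σ : Gal(K/ℚ), σ s = ((quadraticChar (ZMod p)
      (ZMod.unitsMap hpn (IsCyclotomicExtension.Rat.galEquivZMod n K σ)) : ℤ) : K) * s := by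
  have hchar : ringChar (ZMod p) ≠ 2 := by
    rw [ZMod.ringChar_zmod_n]
    rintro rfl
    exact absurd hmod (by decide)
  have hneg : quadraticChar (ZMod p) (-1) = 1 := by
    rw [quadraticChar_one_iff_isSquare (neg_ne_zero.mpr one_ne_zero),
      FiniteField.isSquare_neg_one_iff, ZMod.card]
    have : p % 4 = 1 := hmod
    omega
  let q : MulChar (ZMod p) K := (quadraticChar (ZMod p)).ringHomComp (Int.castRingHom K)
  have hqquad : q.IsQuadratic := (quadraticChar_isQuadratic (ZMod p)).comp _
  have hq1 : q ≠ 1 := (MulChar.ringHomComp_ne_one_iff (Int.cast_injective (α := K))).mpr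
    (quadraticChar_ne_one hchar)
  obtain ⟨d, hd⟩ := hpn
  have hζ : IsPrimitiveRoot (IsCyclotomicExtension.zeta n ℚ K ^ d) p :=
    (IsCyclotomicExtension.zeta_spec n ℚ K).pow (NeZero.pos n) (hd.trans (mul_comm _ _))
  let ψ : AddChar (ZMod p) K := AddChar.zmodChar p hζ.pow_eq_one
  have hψ : ψ.IsPrimitive := AddChar.zmodChar_primitive_of_primitive_root p hζ
  refine ⟨gaussSum q ψ, ?_, fun σ => ?_⟩
  · rw [gaussSum_sq hq1 hqquad hψ, MulChar.ringHomComp_apply, hneg, map_one, one_mul, ZMod.card]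
  · set u := ZMod.unitsMap (Dvd.intro d hd.symm) (IsCyclotomicExtension.Rat.galEquivZMod n K σ)
      with hu
    have hσψ : ∀ a : ZMod p, σ (ψ a) = ψ.mulShift u a := by
      intro a
      have hpow : (ψ a) ^ n = 1 := by
        rw [AddChar.zmodChar_apply, pow_right_comm, pow_right_comm _ d,
          (IsCyclotomicExtension.zeta_spec n ℚ K).pow_eq_one, one_pow, one_pow]
      rw [IsCyclotomicExtension.Rat.galEquivZMod_apply_of_pow_eq n K σ hpow,
        AddChar.mulShift_apply, ← AddChar.map_nsmul_eq_pow, nsmul_eq_mul, hu, ZMod.unitsMap_val,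
        ZMod.natCast_val]
    have hσ : σ (gaussSum q ψ) = gaussSum q (ψ.mulShift u) := by
      simp only [gaussSum, map_sum, map_mul, hσψ, q, MulChar.ringHomComp_apply, eq_intCast,
        map_intCast]
    rw [hσ, gaussSum_mulShift_eq, hqquad.inv]
    rfl

theorem sq_apply_eq_quadraticChar {p : ℕ} [Fact p.Prime] (hmod : p ≡ 1 [MOD 4])
    {χ : DirichletCharacter ℂ p} (hχ : orderOf χ = 4) (u : (ZMod p)ˣ) :
    χ u ^ 2 = ((quadraticChar (ZMod p) u : ℤ) : ℂ) := by
  have hchar : ringChar (ZMod p) ≠ 2 := by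
    rw [ZMod.ringChar_zmod_n]
    rintro rfl
    exact absurd hmod (by decide)
  have h := eq_of_sq_eq_one (η := χ ^ 2)
    (θ := (quadraticChar (ZMod p)).ringHomComp (Int.castRingHom ℂ))
    (by rw [← pow_mul, show 2 * 2 = 4 from rfl, ← hχ, pow_orderOf_eq_one])
    (fun h => absurd (orderOf_dvd_of_pow_eq_one h) (by rw [hχ]; decide))
    ((quadraticChar_isQuadratic (ZMod p)).comp _).sq_eq_one
    ((MulChar.ringHomComp_ne_one_iff (Int.cast_injective (α := ℂ))).mpr
      (quadraticChar_ne_one hchar))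
  rw [← MulChar.pow_apply_coe, h]
  rfl

/-- The field `ℚ(ζ_m)` contains a square root of `m`, on which the Galois group acts through the
quadratic character `∏ j, χ_j ^ 2`. The sign `ε` lives in `ℤ` so that it can be read both in `ℂ`,
where the characters take their values, and in `K`. -/
theorem exists_sqrt_prod {t : ℕ} (p : Fin t → ℕ) [∀ j, Fact (p j).Prime]
    (hmod : ∀ j, p j ≡ 1 [MOD 4]) {χ : ∀ j, DirichletCharacter ℂ (p j)}
    (hχ : ∀ j, orderOf (χ j) = 4) (K : Type*) [Field K] [NumberField K]
    [IsCyclotomicExtension {∏ j, p j} ℚ K] :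
    ∃ s : K, s ^ 2 = (∏ j, p j : ℕ) ∧ ∀ σ : Gal(K/ℚ), ∃ ε : ℤ,
      (ε : ℂ) = charProd p χ (fun _ => 2)
        (IsCyclotomicExtension.Rat.galEquivZMod (∏ j, p j) K σ) ∧ σ s = ε * s := by
  choose s hs hσ using fun j => exists_sqrt_prime (hmod j) (dvd_prod p j) K
  refine ⟨∏ j, s j, ?_, fun σ => ⟨∏ j, quadraticChar (ZMod (p j)) (ZMod.unitsMap (dvd_prod p j)
    (IsCyclotomicExtension.Rat.galEquivZMod (∏ j, p j) K σ)), ?_, ?_⟩⟩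
  · rw [← Finset.prod_pow, Nat.cast_prod]
    exact Finset.prod_congr rfl fun j _ => hs j
  · rw [charProd_apply, Int.cast_prod]
    exact Finset.prod_congr rfl fun j _ => (sq_apply_eq_quadraticChar (hmod j) (hχ j) _).symm
  · rw [map_prod, Int.cast_prod, ← Finset.prod_mul_distrib]
    exact Finset.prod_congr rfl fun j _ => hσ j σ

/-! ### Cyclic quartic subfields of a cyclotomic field and their characters -/

/-- The instance for intermediate fields in Mathlib is about the `ℚ`-algebra structure inherited from
`K`; this one is about the structure that every field of characteristic zero carries. -/
instance isAbelianGalois_intermediateField {K : Type*} [Field K] [NumberField K]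
    [IsAbelianGalois ℚ K] (F : IntermediateField ℚ K) : IsAbelianGalois ℚ F :=
  IsAbelianGalois.of_algHom (RingHom.toRatAlgHom (algebraMap F K))

section Correspondence

open IsCyclotomicExtension.Rat

variable {n : ℕ} [NeZero n] {K : Type*} [Field K] [NumberField K]
  [IsCyclotomicExtension {n} ℚ K] [IsAbelianGalois ℚ K]

/-- Duality for the finite abelian group `(ℤ/n)ˣ`: the characters trivial on `Gal(K/F)` detect
membership in it. -/
theorem mem_fixingSubgroup_iff_forall_char (F : IntermediateField ℚ K) (σ : Gal(K/ℚ)) :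
    σ ∈ F.fixingSubgroup ↔
      ∀ ψ ∈ intermediateFieldEquivSubgroupChar n K ℂ F, ψ (galEquivZMod n K σ) = 1 := by
  rw [← mem_subgroupGalEquivSubgroupChar_symm_iff]
  have : (subgroupGalEquivSubgroupChar n K ℂ).symm
      (OrderDual.toDual (intermediateFieldEquivSubgroupChar n K ℂ F)) = F.fixingSubgroup :=
    (subgroupGalEquivSubgroupChar n K ℂ).symm_apply_apply F.fixingSubgroup
  rw [this]

theorem mem_fixingSubgroup_iff_of_eq_zpowers {F : IntermediateField ℚ K}
    {ψ : DirichletCharacter ℂ n}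
    (hF : intermediateFieldEquivSubgroupChar n K ℂ F = Subgroup.zpowers ψ) (σ : Gal(K/ℚ)) :
    σ ∈ F.fixingSubgroup ↔ ψ (galEquivZMod n K σ) = 1 := by
  rw [mem_fixingSubgroup_iff_forall_char (n := n), hF]
  refine ⟨fun h => h ψ (Subgroup.mem_zpowers ψ), ?_⟩
  rintro h _ ⟨k, rfl⟩
  have h' : ψ.toUnitHom (galEquivZMod n K σ) = 1 := Units.ext (by rw [MulChar.coe_toUnitHom, h]; rfl)
  have hk : (MulChar.mulEquivToUnitHom (ψ ^ k)) (galEquivZMod n K σ) = 1 := by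
    rw [map_zpow, MonoidHom.zpow_apply, MulChar.mulEquivToUnitHom_apply, ← MulChar.toUnitHom_eq,
      h', one_zpow]
  rw [MulChar.mulEquivToUnitHom_apply, ← MulChar.toUnitHom_eq] at hk
  change (ψ ^ k) _ = 1
  rw [← MulChar.coe_toUnitHom, hk, Units.val_one]

theorem restrictNormal_sq_eq_one_iff (F : IntermediateField ℚ K) (σ : Gal(K/ℚ)) :
    σ.restrictNormal F ^ 2 = 1 ↔ σ ^ 2 ∈ F.fixingSubgroup := by
  have : σ.restrictNormal F ^ 2 = (σ ^ 2).restrictNormal F :=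
    (map_pow (AlgEquiv.restrictNormalHom F) σ 2).symm
  rw [this]
  refine ⟨fun h => (mem_fixingSubgroup_iff F _).mpr fun x hx => ?_,
    fun h => AlgEquiv.ext fun x => (algebraMap F K).injective ?_⟩
  · have hx' := AlgEquiv.restrictNormal_commutes (σ ^ 2) F ⟨x, hx⟩
    rw [h] at hx'
    exact hx'.symm
  · rw [AlgEquiv.restrictNormal_commutes]
    exact (mem_fixingSubgroup_iff F _).mp h x x.2

theorem forall_mem_zpowers_of_sq_ne_one {G : Type*} [Group G] [Finite G] (hcard : Nat.card G = 4)
    {g : G} (hg : g ^ 2 ≠ 1) (x : G) : x ∈ Subgroup.zpowers g := by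
  have h4 : orderOf g = 4 := orderOf_eq_four_of_sq hg
    (by rw [← pow_mul, show 2 * 2 = 4 from rfl, ← hcard, pow_card_eq_one'])
  rw [Subgroup.eq_top_of_card_eq (Subgroup.zpowers g) (by rw [Nat.card_zpowers, h4, hcard])]
  exact Subgroup.mem_top x

theorem finrank_eq_four_of_eq_zpowers {F : IntermediateField ℚ K} {ψ : DirichletCharacter ℂ n}
    (hψ : orderOf ψ = 4)
    (hF : intermediateFieldEquivSubgroupChar n K ℂ F = Subgroup.zpowers ψ) :
    Module.finrank ℚ F = 4 := by
  rw [← card_intermediateFieldEquivSubgroupChar n K ℂ F, hF, Nat.card_zpowers, hψ]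

/-- If `F` belongs to a character `ψ` of order four, every `σ` with `ψ σ = ±i` restricts to a
generator of `Gal(F/ℚ)`. -/
theorem exists_generator_of_eq_zpowers {F : IntermediateField ℚ K} {ψ : DirichletCharacter ℂ n}
    (hψ : orderOf ψ = 4)
    (hF : intermediateFieldEquivSubgroupChar n K ℂ F = Subgroup.zpowers ψ) :
    ∃ σ : Gal(K/ℚ), ψ (galEquivZMod n K σ) ^ 2 = -1 ∧
      ∀ x, x ∈ Subgroup.zpowers (σ.restrictNormal F) := by
  obtain ⟨u, hu⟩ := exists_sq_apply_eq_neg_one hψ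
  obtain ⟨σ, rfl⟩ := (galEquivZMod n K).surjective u
  refine ⟨σ, hu, forall_mem_zpowers_of_sq_ne_one ?_ ?_⟩
  · rw [IsGalois.card_aut_eq_finrank, finrank_eq_four_of_eq_zpowers hψ hF]
  · rw [ne_eq, restrictNormal_sq_eq_one_iff, mem_fixingSubgroup_iff_of_eq_zpowers hF, map_pow,
      Units.val_pow_eq_pow_val, map_pow, hu]
    norm_num

/-- A cyclic quartic subfield belongs to a character of order four: otherwise all its characters
would have order at most two, and so would all elements of its Galois group, by duality. -/
theorem exists_eq_zpowers_of_isCyclic {F : IntermediateField ℚ K} (hF : Module.finrank ℚ F = 4)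
    [IsCyclic Gal(F/ℚ)] : ∃ ψ : DirichletCharacter ℂ n, orderOf ψ = 4 ∧
      intermediateFieldEquivSubgroupChar n K ℂ F = Subgroup.zpowers ψ := by
  have hX : Nat.card (intermediateFieldEquivSubgroupChar n K ℂ F) = 4 := by
    rw [card_intermediateFieldEquivSubgroupChar n K ℂ F, hF]
  have hG : Nat.card Gal(F/ℚ) = 4 := by rw [IsGalois.card_aut_eq_finrank, hF]
  suffices ∃ ψ ∈ intermediateFieldEquivSubgroupChar n K ℂ F, ψ ^ 2 ≠ 1 by
    obtain ⟨ψ, hψ, h2⟩ := this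
    have hψ4 : ψ ^ 4 = 1 := by
      have := pow_card_eq_one' (x := (⟨ψ, hψ⟩ : intermediateFieldEquivSubgroupChar n K ℂ F))
      rw [hX] at this
      exact congrArg Subtype.val this
    have h4 : orderOf ψ = 4 := orderOf_eq_four_of_sq h2 (by rwa [← pow_mul])
    refine ⟨ψ, h4, (Subgroup.eq_of_le_of_card_ge ?_ ?_).symm⟩
    · exact Subgroup.zpowers_le.mpr hψ
    · rw [hX, Nat.card_zpowers, h4]
  by_contra! hall
  obtain ⟨g, hg⟩ := IsCyclic.exists_generator (α := Gal(F/ℚ))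
  obtain ⟨σ, rfl⟩ := AlgEquiv.restrictNormalHom_surjective (F := ℚ) (K₁ := F) K g
  have h2 : σ.restrictNormal F ^ 2 = 1 := by
    rw [restrictNormal_sq_eq_one_iff, mem_fixingSubgroup_iff_forall_char (n := n)]
    intro ψ hψ
    rw [map_pow, Units.val_pow_eq_pow_val, map_pow, ← MulChar.pow_apply_coe, hall ψ hψ,
      MulChar.one_apply_coe]
  have h4 : orderOf (σ.restrictNormal F) = 4 := by
    rw [← hG]
    exact orderOf_eq_card_of_forall_mem_zpowers hg
  exact absurd (orderOf_dvd_of_pow_eq_one h2) (by rw [h4]; decide)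

end Correspondence

section Discriminant

open IsCyclotomicExtension.Rat

variable {t : ℕ} (p : Fin t → ℕ) [∀ j, Fact (p j).Prime]
  (hinj : Function.Injective p) (hmod : ∀ j, p j ≡ 1 [MOD 4])
  {χ : ∀ j, DirichletCharacter ℂ (p j)} (hχ : ∀ j, orderOf (χ j) = 4)
  {K : Type*} [Field K] [NumberField K] [IsCyclotomicExtension {∏ j, p j} ℚ K]
  [IsAbelianGalois ℚ K]

include hinj in
theorem squarefree_prod : Squarefree (∏ j, p j) :=
  Finset.squarefree_prod_of_pairwise_isCoprime
    (fun _ _ _ _ hij => Nat.coprime_iff_isRelPrime.mp (pairwise_coprime p hinj hij))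
    fun j _ => (Fact.out : (p j).Prime).prime.irreducible.squarefree

include hinj hmod hχ in
/-- The field of a character `ψ` with `ψ ^ 2 = ∏ j, χ_j ^ 2` contains `√m` and therefore has
discriminant `m ^ 3`. -/
theorem discr_eq_of_mem_oddChars (ht : 1 ≤ t) {ψ : DirichletCharacter ℂ (∏ j, p j)}
    (hψ : ψ ∈ oddChars p χ) {F : IntermediateField ℚ K}
    (hF : intermediateFieldEquivSubgroupChar (∏ j, p j) K ℂ F = Subgroup.zpowers ψ) :
    NumberField.discr F = ((∏ j, p j : ℕ) : ℤ) ^ 3 := by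
  have h4 := orderOf_eq_four_of_mem_oddChars p hinj hχ ht hψ
  rw [mem_oddChars_iff p hinj hχ] at hψ
  obtain ⟨s, hs, hσs⟩ := exists_sqrt_prod p hmod hχ K
  have hsF : s ∈ F := by
    rw [← IsGalois.fixedField_fixingSubgroup F, IntermediateField.mem_fixedField_iff]
    intro τ hτ
    obtain ⟨ε, hε, hτs⟩ := hσs τ
    rw [mem_fixingSubgroup_iff_of_eq_zpowers hF] at hτ
    rw [← hψ, MulChar.pow_apply_coe, hτ, one_pow] at hε
    rw [hτs, (by exact_mod_cast hε : ε = 1), Int.cast_one, one_mul]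
  obtain ⟨σ, hσ, hgen⟩ := exists_generator_of_eq_zpowers h4 hF
  refine discr_eq_pow_three (squarefree_prod p hinj) F (finrank_eq_four_of_eq_zpowers h4 hF) hgen
    (s := ⟨s, hsF⟩) (Subtype.ext (by simpa using hs)) ?_
  apply (algebraMap F K).injective
  rw [AlgEquiv.restrictNormal_commutes, map_neg]
  obtain ⟨ε, hε, hσs⟩ := hσs σ
  rw [← hψ, MulChar.pow_apply_coe, hσ] at hε
  change σ s = -s
  rw [hσs, (by exact_mod_cast hε : ε = -1), Int.cast_neg, Int.cast_one, neg_one_mul]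

include hinj hmod hχ in
/-- A cyclic quartic field of discriminant `m ^ 3` contains `√(m ^ 3)`, hence `√m`, so its character
group contains `∏ j, χ_j ^ 2`, which must be the square of a generator. -/
theorem exists_mem_oddChars_of_discr_eq (ht : 1 ≤ t) {F : IntermediateField ℚ K}
    (hF : Module.finrank ℚ F = 4) [IsCyclic Gal(F/ℚ)]
    (hd : NumberField.discr F = ((∏ j, p j : ℕ) : ℤ) ^ 3) :
    ∃ ψ ∈ oddChars p χ,
      intermediateFieldEquivSubgroupChar (∏ j, p j) K ℂ F = Subgroup.zpowers ψ := by
  classical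
  obtain ⟨ψ, h4, hψF⟩ := exists_eq_zpowers_of_isCyclic (n := ∏ j, p j) hF
  refine ⟨ψ, ?_, hψF⟩
  obtain ⟨s, hs, hσs⟩ := exists_sqrt_prod p hmod hχ K
  have hm0 : ((∏ j, p j : ℕ) : K) ≠ 0 := Nat.cast_ne_zero.mpr (NeZero.ne _)
  have hs0 : s ≠ 0 := by rintro rfl; exact hm0 (by simpa using hs.symm)
  have hsF : s ∈ F := by
    obtain ⟨δ, hδ, -⟩ := exists_sq_eq_discr F
    have hδK : (δ : K) ^ 2 = (((∏ j, p j : ℕ) : K) * s) ^ 2 := by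
      have := congrArg (algebraMap F K) hδ
      rw [hd] at this
      rw [mul_pow, hs]
      simpa [pow_succ] using this
    have hmF : ((∏ j, p j : ℕ) : K) ∈ F := IntermediateField.natCast_mem F _
    have hmem : ((∏ j, p j : ℕ) : K) * s ∈ F := by
      rcases sq_eq_sq_iff_eq_or_eq_neg.mp hδK with h | h
      · exact h ▸ δ.2
      · rw [← neg_neg (_ * s), ← h]
        exact neg_mem δ.2
    have := F.mul_mem (F.inv_mem hmF) hmem
    rwa [inv_mul_cancel_left₀ hm0] at this
  have hκ : (charProd p χ fun _ => 2) ∈ Subgroup.zpowers ψ := by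
    rw [← hψF, mem_intermediateFieldEquivSubgroupChar_iff]
    intro σ hσ
    obtain ⟨ε, hε, h⟩ := hσs σ
    rw [(mem_fixingSubgroup_iff F σ).mp hσ s hsF] at h
    have : (ε : K) = 1 := mul_right_cancel₀ hs0 (by rw [← h, one_mul])
    rw [← hε, (by exact_mod_cast this : ε = 1), Int.cast_one]
  have hκ1 := charProd_two_ne_one p hinj hχ ht
  have hκ2 := charProd_two_sq p hχ
  rw [mem_oddChars_iff p hinj hχ]
  have hfin : IsOfFinOrder ψ := orderOf_pos_iff.mp (by omega)
  obtain ⟨k, hk, hkκ⟩ := Finset.mem_image.mp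
    (hfin.mem_powers_iff_mem_range_orderOf.mp (hfin.mem_powers_iff_mem_zpowers.mpr hκ))
  rw [h4, Finset.mem_range] at hk
  rw [← hkκ] at hκ1 hκ2 ⊢
  have hdvd : 4 ∣ k * 2 := h4 ▸ orderOf_dvd_of_pow_eq_one (by rwa [pow_mul])
  have hk0 : k ≠ 0 := by rintro rfl; exact hκ1 (pow_zero ψ)
  rw [show k = 2 by omega]

end Discriminant

/-! ### Subfields of the complex numbers -/

/-- The field of the pair `{ψ, ψ ^ 3}` is the one that belongs to the group generated by `ψ`. -/
theorem fieldOfChars_pair {n : ℕ} [NeZero n] (ψ : DirichletCharacter ℂ n) :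
    fieldOfChars n {ψ, ψ ^ 3} = IntermediateField.lift
      ((IsCyclotomicExtension.Rat.intermediateFieldEquivSubgroupChar n (cyclo n) ℂ).symm
        (Subgroup.zpowers ψ)) := by
  have h : fixedField (commonKer n {ψ, ψ ^ 3}) =
      (IsCyclotomicExtension.Rat.intermediateFieldEquivSubgroupChar n (cyclo n) ℂ).symm
        (Subgroup.zpowers ψ) := by
    rw [IsGalois.fixedField_eq_iff_fixingSubgroup_eq]
    ext σ
    rw [mem_fixingSubgroup_iff_of_eq_zpowers (OrderIso.apply_symm_apply _ _)]
    change _ ↔ ∀ φ ∈ ({ψ, ψ ^ 3} : Set _), _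
    simp only [Set.mem_insert_iff, Set.mem_singleton_iff, forall_eq_or_imp, forall_eq,
      MulChar.pow_apply_coe]
    exact ⟨fun h => ⟨h, by rw [h, one_pow]⟩, fun h => h.1⟩
  rw [fieldOfChars, h]
  rfl

theorem lift_injective {k E : Type*} [Field k] [Field E] [Algebra k E]
    (K : IntermediateField k E) :
    Function.Injective (IntermediateField.lift : IntermediateField k K → IntermediateField k E) :=
  IntermediateField.map_injective K.val

instance lift_numberField {n : ℕ} [NeZero n] (F : IntermediateField ℚ (cyclo n)) :
    NumberField (lift F) :=
  NumberField.of_ringEquiv _ _ (liftAlgEquiv F).toRingEquiv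

theorem discr_lift {n : ℕ} [NeZero n] (F : IntermediateField ℚ (cyclo n)) :
    NumberField.discr (lift F) = NumberField.discr F :=
  (NumberField.discr_eq_discr_of_algEquiv F (liftAlgEquiv F)).symm

theorem isCyclicQuartic_lift_iff {n : ℕ} [NeZero n] (F : IntermediateField ℚ (cyclo n)) :
    IsCyclicQuartic (lift F) ↔ Module.finrank ℚ F = 4 ∧ IsCyclic Gal(F/ℚ) := by
  have hcyc : IsCyclic Gal(lift F/ℚ) ↔ IsCyclic Gal(F/ℚ) :=
    (AlgEquiv.autCongr (liftAlgEquiv F)).isCyclic.symm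
  have hgal : IsAbelianGalois ℚ (lift F) :=
    IsAbelianGalois.of_algHom (F.val.comp (liftAlgEquiv F).symm.toAlgHom)
  rw [IsCyclicQuartic, hcyc, ← (liftAlgEquiv F).toLinearEquiv.finrank_eq]
  exact ⟨fun h => ⟨h.1, h.2.2⟩, fun h => ⟨h.1, hgal.toIsGalois, h.2⟩⟩

theorem le_cyclo_of_conductor_eq {m : ℕ} (hm : m ≠ 0) {L : IntermediateField ℚ ℂ}
    (h : conductor L = m) : L ≤ cyclo m := by
  have hne : {n : ℕ | 0 < n ∧ L ≤ cyclo n}.Nonempty := by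
    by_contra hempty
    rw [Set.not_nonempty_iff_eq_empty] at hempty
    rw [conductor, hempty, Nat.sInf_empty] at h
    exact hm h.symm
  have := (Nat.sInf_mem hne).2
  rwa [show sInf _ = m from h] at this

/-- As the discriminant of a subfield of `ℚ(ζ_n)` divides a power of `n`, a field of discriminant
`m ^ 3`, `m` squarefree, can lie in `ℚ(ζ_n)` only if `m ∣ n`. -/
theorem conductor_eq_of_discr_eq {m : ℕ} [NeZero m] (hm : Squarefree m)
    {L : IntermediateField ℚ ℂ} [NumberField L] (hL : L ≤ cyclo m)
    (hd : NumberField.discr L = (m : ℤ) ^ 3) : conductor L = m := by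
  refine le_antisymm (Nat.sInf_le ⟨NeZero.pos m, hL⟩)
    (le_csInf ⟨m, NeZero.pos m, hL⟩ ?_)
  rintro n ⟨hn, hLn⟩
  have : NeZero n := ⟨hn.ne'⟩
  let : Algebra L (cyclo n) := (IntermediateField.inclusion hLn).toRingHom.toAlgebra
  have h1 : (NumberField.discr L).natAbs ∣ (NumberField.discr (cyclo n)).natAbs :=
    Int.natAbs_dvd_natAbs.mpr (NumberField.discr_dvd_discr L (cyclo n))
  rw [hd, Int.natAbs_pow, Int.natAbs_natCast, IsCyclotomicExtension.Rat.natAbs_discr n] at h1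
  have h2 : m ∣ n ^ n.totient := (dvd_pow_self m three_ne_zero).trans (h1.trans
    (Nat.div_dvd_of_dvd (Nat.prod_primeFactors_pow_totient_ediv_dvd hn)))
  exact Nat.le_of_dvd hn
    ((hm.dvd_pow_iff_dvd (Nat.totient_pos.mpr hn).ne').mp h2)

section Bijection

open IsCyclotomicExtension.Rat

variable {t : ℕ} (p : Fin t → ℕ) [∀ j, Fact (p j).Prime]
  (hinj : Function.Injective p) (hmod : ∀ j, p j ≡ 1 [MOD 4])
  {χ : ∀ j, DirichletCharacter ℂ (p j)} (hχ : ∀ j, orderOf (χ j) = 4)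

include hinj hmod hχ in
theorem fieldOfChars_mem_quarticFields (ht : 1 ≤ t) {ψ : DirichletCharacter ℂ (∏ j, p j)}
    (hψ : ψ ∈ oddChars p χ) :
    fieldOfChars (∏ j, p j) {ψ, ψ ^ 3} ∈ quarticFields (∏ j, p j) := by
  rw [fieldOfChars_pair]
  set F := (intermediateFieldEquivSubgroupChar (∏ j, p j) (cyclo (∏ j, p j)) ℂ).symm
    (Subgroup.zpowers ψ) with hFdef
  have hF : intermediateFieldEquivSubgroupChar (∏ j, p j) (cyclo (∏ j, p j)) ℂ F =
    Subgroup.zpowers ψ := OrderIso.apply_symm_apply _ _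
  have h4 := orderOf_eq_four_of_mem_oddChars p hinj hχ ht hψ
  have hd : NumberField.discr (lift F) = ((∏ j, p j : ℕ) : ℤ) ^ 3 := by
    rw [discr_lift, discr_eq_of_mem_oddChars p hinj hmod hχ ht hψ hF]
  refine ⟨(isCyclicQuartic_lift_iff F).mpr ⟨finrank_eq_four_of_eq_zpowers h4 hF, ?_⟩,
    conductor_eq_of_discr_eq (squarefree_prod p hinj) (lift_le F) hd, inferInstance, hd⟩
  obtain ⟨σ, -, hσ⟩ := exists_generator_of_eq_zpowers h4 hF
  exact ⟨_, hσ⟩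

include hinj hmod hχ in
theorem exists_eq_fieldOfChars (ht : 1 ≤ t) {L : IntermediateField ℚ ℂ}
    (hL : L ∈ quarticFields (∏ j, p j)) :
    ∃ ψ ∈ oddChars p χ, fieldOfChars (∏ j, p j) {ψ, ψ ^ 3} = L := by
  obtain ⟨hquart, hcond, hnf, hd⟩ := hL
  have hle := le_cyclo_of_conductor_eq (NeZero.ne _) hcond
  obtain ⟨F, rfl⟩ : ∃ F : IntermediateField ℚ (cyclo (∏ j, p j)), lift F = L :=
    ⟨restrict hle, lift_restrict hle⟩
  rw [isCyclicQuartic_lift_iff] at hquart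
  have := hquart.2
  rw [discr_lift] at hd
  obtain ⟨ψ, hψ, hF⟩ := exists_mem_oddChars_of_discr_eq p hinj hmod hχ ht hquart.1 hd
  refine ⟨ψ, hψ, ?_⟩
  rw [fieldOfChars_pair, ← hF, OrderIso.symm_apply_apply]

include hinj hmod hχ in
theorem bijOn_fieldOfChars (ht : 1 ≤ t) :
    Set.BijOn (fieldOfChars (∏ j, p j)) {Q | ∃ ψ ∈ oddChars p χ, Q = {ψ, ψ ^ 3}}
      (quarticFields (∏ j, p j)) := by
  refine ⟨?_, ?_, ?_⟩
  · rintro _ ⟨ψ, hψ, rfl⟩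
    exact fieldOfChars_mem_quarticFields p hinj hmod hχ ht hψ
  · rintro _ ⟨ψ, hψ, rfl⟩ _ ⟨φ, hφ, rfl⟩ h
    rw [fieldOfChars_pair, fieldOfChars_pair] at h
    have hz : Subgroup.zpowers ψ = Subgroup.zpowers φ :=
      (OrderIso.injective _) (lift_injective _ h)
    have hψ4 := orderOf_eq_four_of_mem_oddChars p hinj hχ ht hψ
    have hφ4 := orderOf_eq_four_of_mem_oddChars p hinj hχ ht hφ
    rcases eq_or_eq_pow_three_of_mem_zpowers hψ4 hφ4 (hz ▸ Subgroup.mem_zpowers φ) with rfl | rfl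
    · rfl
    · have h9 : (ψ ^ 3) ^ 3 = ψ := by
        rw [← pow_mul, show 3 * 3 = 4 * 2 + 1 by norm_num, pow_succ, pow_mul,
          ← hψ4, pow_orderOf_eq_one, one_pow, one_mul]
      rw [h9, Set.pair_comm]
  · intro L hL
    obtain ⟨ψ, hψ, rfl⟩ := exists_eq_fieldOfChars p hinj hmod hχ ht hL
    exact ⟨_, ⟨ψ, hψ, rfl⟩, rfl⟩

end Bijection

theorem exists_orderOf_eq_four {p : ℕ} [Fact p.Prime] (hmod : p ≡ 1 [MOD 4]) :
    ∃ χ : DirichletCharacter ℂ p, orderOf χ = 4 := by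
  refine MulChar.exists_mulChar_orderOf (ZMod p) ?_ (Complex.isPrimitiveRoot_exp 4 (by norm_num))
  rw [ZMod.card]
  exact (Nat.modEq_iff_dvd' (Fact.out : p.Prime).one_lt.le).mp hmod.symm

end CyclicQuartic

theorem mainTheorem2 (t : ℕ) (ht : 1 ≤ t) (p : Fin t → ℕ) [∀ j, Fact (p j).Prime]
    (hinj : Function.Injective p) (hmod : ∀ j, p j ≡ 1 [MOD 4]) :
    (CyclicQuartic.quarticFields (∏ j, p j)).ncard = 2 ^ (t - 1) ∧
    ∀ χ : ∀ j, DirichletCharacter ℂ (p j), (∀ j, orderOf (χ j) = 4) →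
      (∀ ψ ∈ CyclicQuartic.oddChars p χ,
        orderOf ψ = 4 ∧ ψ ^ 3 ≠ ψ ∧ ψ ^ 3 ∈ CyclicQuartic.oddChars p χ) ∧
      Set.BijOn (CyclicQuartic.fieldOfChars (∏ j, p j))
        {Q | ∃ ψ ∈ CyclicQuartic.oddChars p χ, Q = {ψ, ψ ^ 3}}
        (CyclicQuartic.quarticFields (∏ j, p j)) := by
  refine ⟨?_, fun χ hχ => ⟨fun ψ hψ => ?_, ?_⟩⟩
  · choose χ hχ using fun j => CyclicQuartic.exists_orderOf_eq_four (hmod j)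
    have hbij := CyclicQuartic.bijOn_fieldOfChars p hinj hmod hχ ht
    rw [← hbij.image_eq, hbij.injOn.ncard_image]
    have h := CyclicQuartic.two_mul_ncard_pairs p hinj hχ ht
    obtain ⟨k, rfl⟩ : ∃ k, t = k + 1 := ⟨t - 1, by omega⟩
    rw [pow_succ] at h
    rw [Nat.add_sub_cancel]
    omega
  · have h4 := CyclicQuartic.orderOf_eq_four_of_mem_oddChars p hinj hχ ht hψ
    refine ⟨h4, CyclicQuartic.pow_three_ne_of_orderOf_eq_four h4,
      CyclicQuartic.pow_three_mem_oddChars p hinj hχ hψ⟩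
  · exact CyclicQuartic.bijOn_fieldOfChars p hinj hmod hχ ht
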